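/- Let $X$ be a real Banach space with closed unit ball $B_X$, let $u\in X$ with $\|u\|=1$, and suppose that $u$ is a big point, i.e. $\overline{\mathrm{conv}}\{T(u) : T\colon X\to X \text{ a surjective linear isometry}\}=B_X$. Let $P\colon X\to X$ be a bicontractive linear projection onto the line $[u]=\mathbb{R}u$, i.e. $P$ is a bounded linear operator with $P^2=P$, $P(X)=\mathbb{R}u$ and $\|P\|=\|I-P\|=1$. Assume that at least one of the following conditions holds: (a) for every sequence $(x_n)\subset B_X$ with $\|u+x_n\|\to 2$ one has $P(x_n)\to u$; (b) the dual $X^*$ is weak*-LUR, i.e. for every $f\in X^*$ with $\|f\|=1$ and every sequence $(f_n)$ in the closed unit ball of $X^*$ with $\|f+f_n\|\to 2$, one has $f_n\to f$ in the weak* topology. Then $X$ is isometrically a Hilbert space, i.e. there is a linear isometry of $X$ onto a complete real inner product space. -/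

import Mathlib

open Filter Topology

/-- The orbit of `x` under the group of rotations (surjective linear isometries) of `X`. -/
def rotationOrbit {X : Type*} [NormedAddCommGroup X] [NormedSpace ℝ X] (x : X) : Set X :=
  {y | ∃ T : X ≃ₗᵢ[ℝ] X, T x = y}

/-- `u` is a big point: a unit vector such that the closed convex hull of its rotation orbit is
the closed unit ball. -/
def IsBigPoint {X : Type*} [NormedAddCommGroup X] [NormedSpace ℝ X] (u : X) : Prop :=
  ‖u‖ = 1 ∧ closure (convexHull ℝ (rotationOrbit u)) = Metric.closedBall (0 : X) 1

/-- `P` is a bicontractive (linear) projection of `X` onto the one-dimensional subspace `[u]`. -/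
structure IsBicontractiveProjectionOnto {X : Type*} [NormedAddCommGroup X] [NormedSpace ℝ X]
    (P : X →L[ℝ] X) (u : X) : Prop where
  idem : ∀ x, P (P x) = P x
  range_eq : LinearMap.range (P : X →ₗ[ℝ] X) = Submodule.span ℝ {u}
  norm_eq : ‖P‖ = 1
  norm_compl_eq : ‖ContinuousLinearMap.id ℝ X - P‖ = 1

/-- The dual of `X` is weak*-LUR (locally uniformly rotund with respect to the weak* topology):
for each `f` in its unit sphere, every sequence `f_n` in its unit ball with `‖f + f_n‖ → 2`
converges to `f` in the weak* topology. -/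
def DualIsWeakStarLUR (X : Type*) [NormedAddCommGroup X] [NormedSpace ℝ X] : Prop :=
  ∀ f : StrongDual ℝ X, ‖f‖ = 1 → ∀ g : ℕ → StrongDual ℝ X, (∀ n, ‖g n‖ ≤ 1) →
    Tendsto (fun n => ‖f + g n‖) atTop (𝓝 2) →
    Tendsto (fun n => StrongDual.toWeakDual (g n)) atTop (𝓝 (StrongDual.toWeakDual f))

/-- `X` is isometrically a Hilbert space: there is a linear isometry of `X` onto a real complete
inner product space. -/
def IsIsometricallyHilbert.{v} (X : Type v) [NormedAddCommGroup X] [NormedSpace ℝ X] : Prop :=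
  ∃ (H : Type v) (_ : NormedAddCommGroup H) (_ : InnerProductSpace ℝ H) (_ : CompleteSpace H),
    Nonempty (X ≃ₗᵢ[ℝ] H)

/-- A unit vector `y` and a functional `ψ` such that `z ↦ ψ z • y` is a projection of norm one
whose complementary projection is contractive as well. -/
structure IsBicontractivePair {Y : Type*} [NormedAddCommGroup Y] [NormedSpace ℝ Y]
    (y : Y) (ψ : StrongDual ℝ Y) : Prop where
  norm_vec : ‖y‖ = 1
  norm_le : ‖ψ‖ ≤ 1
  apply_self : ψ y = 1
  norm_compl_le : ∀ z, ‖z - ψ z • y‖ ≤ ‖z‖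

/-- A selection of support functionals whose associated orthogonality relation is symmetric. -/
structure IsSymmetricSupport {Y : Type*} [NormedAddCommGroup Y] [NormedSpace ℝ Y]
    (J : Y → StrongDual ℝ Y) : Prop where
  norm_le : ∀ x, ‖J x‖ ≤ 1
  apply_self : ∀ x, J x x = ‖x‖
  symm : ∀ x y, J x y = 0 → J y x = 0

theorem StrongDual.apply_le_norm {Y : Type*} [NormedAddCommGroup Y] [NormedSpace ℝ Y]
    {f : StrongDual ℝ Y} (hf : ‖f‖ ≤ 1) (y : Y) : f y ≤ ‖y‖ :=
  (le_abs_self _).trans ((f.le_opNorm y).trans (mul_le_of_le_one_left (norm_nonneg y) hf))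

theorem StrongDual.abs_apply_le_norm {Y : Type*} [NormedAddCommGroup Y] [NormedSpace ℝ Y]
    {f : StrongDual ℝ Y} (hf : ‖f‖ ≤ 1) (y : Y) : |f y| ≤ ‖y‖ :=
  (f.le_opNorm y).trans (mul_le_of_le_one_left (norm_nonneg y) hf)

theorem exists_isSymmetricSupport {Y : Type*} [NormedAddCommGroup Y] [NormedSpace ℝ Y]
    [StrictConvexSpace ℝ Y]
    (hY : ∀ y : Y, ‖y‖ = 1 → ∃ ψ : StrongDual ℝ Y, IsBicontractivePair y ψ) :
    ∃ J : Y → StrongDual ℝ Y, IsSymmetricSupport J := by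
  classical
  have key : ∀ (x y : Y) (φ ψ : StrongDual ℝ Y), IsBicontractivePair x φ →
      IsBicontractivePair y ψ → φ y = 0 → ψ x = 0 := by
    intro x y φ ψ hx hy h
    have hge : ∀ t : ℝ, 1 ≤ ‖x - t • y‖ := by
      intro t
      have := StrongDual.apply_le_norm hx.norm_le (x - t • y)
      simpa [h, hx.apply_self] using this
    by_contra hne
    have h1 : x ≠ x - ψ x • y := by
      intro h2
      have h3 : ψ x • y = 0 := by
        have := sub_eq_self.mp h2.symm
        exact this
      rcases smul_eq_zero.mp h3 with h4 | h4
      · exact hne h4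
      · have := hy.norm_vec
        simp [h4] at this
    have h5 := norm_combo_lt_of_ne (r := 1) hx.norm_vec.le
      ((hy.norm_compl_le x).trans hx.norm_vec.le) h1 (a := 1/2) (b := 1/2)
      (by norm_num) (by norm_num) (by norm_num)
    have h6 := hge (1 / 2 * ψ x)
    have h7 : (1 / 2 : ℝ) • x + (1 / 2 : ℝ) • (x - ψ x • y) = x - (1 / 2 * ψ x) • y := by
      module
    rw [h7] at h5
    linarith
  have hunit : ∀ x : Y, x ≠ 0 → ‖‖x‖⁻¹ • x‖ = 1 := by
    intro x hx
    rw [norm_smul, norm_inv, norm_norm, inv_mul_cancel₀ (norm_ne_zero_iff.mpr hx)]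
  choose! φ hφ using hY
  refine ⟨fun x => if x = 0 then 0 else φ (‖x‖⁻¹ • x), ⟨?_, ?_, ?_⟩⟩
  · intro x
    by_cases hx : x = 0
    · simp [hx]
    · simpa [hx] using (hφ _ (hunit x hx)).norm_le
  · intro x
    by_cases hx : x = 0
    · simp [hx]
    · have h := (hφ _ (hunit x hx)).apply_self
      have hn : ‖x‖ ≠ 0 := norm_ne_zero_iff.mpr hx
      simp only [hx, if_false]
      rw [map_smul, smul_eq_mul, inv_mul_eq_one₀ hn] at h
      exact h.symm
  · intro x y h
    by_cases hx : x = 0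
    · simp [hx]
    by_cases hy : y = 0
    · simp [hy]
    simp only [hx, hy, if_false] at h ⊢
    have h1 := key _ _ _ _ (hφ _ (hunit x hx)) (hφ _ (hunit y hy)) (by rw [map_smul, h, smul_zero])
    rw [map_smul, smul_eq_mul] at h1
    exact (mul_eq_zero.mp h1).resolve_left (inv_ne_zero (norm_ne_zero_iff.mpr hx))

theorem additive_eq_mul_of_mul_nonneg {r : ℝ → ℝ} (hadd : ∀ s t, r (s + t) = r s + r t)
    (hsign : ∀ t, 0 ≤ t * r t) (t : ℝ) : r t = r 1 * t := by
  let R : ℝ →+ ℝ := AddMonoidHom.mk' r hadd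
  have hq : ∀ q : ℚ, r q = q * r 1 := by
    intro q
    have := map_rat_smul R q (1 : ℝ)
    simpa [R, Rat.smul_def] using this
  have hnn : ∀ t, 0 ≤ t → 0 ≤ r t := by
    intro t ht
    rcases ht.eq_or_lt with h | h
    · have := hadd 0 0
      rw [← h]
      simp at this
      exact this.ge
    · exact nonneg_of_mul_nonneg_right (hsign t) h
  have hmono : Monotone r := by
    intro a b hab
    have := hadd a (b - a)
    rw [add_sub_cancel] at this
    linarith [hnn (b - a) (by linarith)]
  have h1 : 0 ≤ r 1 := hnn 1 zero_le_one
  have hup : ∀ t, r t ≤ r 1 * t := by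
    intro t
    refine le_of_forall_pos_le_add fun ε hε => ?_
    obtain ⟨q, hq1, hq2⟩ := exists_rat_btwn (show t < t + ε / (r 1 + 1) by
      have : 0 < ε / (r 1 + 1) := by positivity
      linarith)
    have h2 := hmono hq1.le
    rw [hq] at h2
    have h3 : r 1 * (ε / (r 1 + 1)) ≤ ε := by
      rw [mul_div_assoc', div_le_iff₀ (by positivity)]
      nlinarith
    nlinarith
  have h0 : r (-t) = - r t := map_neg R t
  have := hup (-t)
  rw [h0] at this
  linarith [hup t]

namespace IsSymmetricSupport

variable {Y : Type*} [NormedAddCommGroup Y] [NormedSpace ℝ Y] {J : Y → StrongDual ℝ Y}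

theorem add_smul (hJ : IsSymmetricSupport J) {x y z : Y} (hx : J x z = 0) (hy : J y z = 0)
    (t : ℝ) : J (x + t • y) z = 0 := by
  apply hJ.symm
  rw [map_add, map_smul, hJ.symm _ _ hx, hJ.symm _ _ hy]
  simp

theorem add (hJ : IsSymmetricSupport J) {x y z : Y} (hx : J x z = 0) (hy : J y z = 0) :
    J (x + y) z = 0 := by
  simpa using hJ.add_smul hx hy 1

theorem apply_ne_zero (hJ : IsSymmetricSupport J) {x y : Y} (h : J y x = 1) : J x y ≠ 0 :=
  fun h0 => by simp [hJ.symm _ _ h0] at h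

/-- For orthogonal `a`, `b`, the ratio of the values of the support functional at `a + t b`. -/
noncomputable def ratio (J : Y → StrongDual ℝ Y) (a b : Y) (t : ℝ) : ℝ :=
  J (a + t • b) b / J (a + t • b) a

theorem apply_left_add (hJ : IsSymmetricSupport J) {a b : Y} (ha : ‖a‖ = 1) (hab : J a b = 0)
    (t : ℝ) : J a (a + t • b) = 1 := by
  rw [map_add, map_smul, hab, hJ.apply_self, ha]; simp

theorem ratio_mul (hJ : IsSymmetricSupport J) {a b : Y} (ha : ‖a‖ = 1) (hab : J a b = 0)
    (t : ℝ) : J (a + t • b) b = ratio J a b t * J (a + t • b) a := by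
  rw [ratio, div_mul_cancel₀]
  exact hJ.apply_ne_zero (hJ.apply_left_add ha hab t)

theorem apply_nonneg (hJ : IsSymmetricSupport J) {a b : Y} (hb : ‖b‖ = 1)
    (hab : J a b = 0) (t : ℝ) : 0 ≤ J (a + t • b) a := by
  have h1 := hJ.apply_self (a + t • b)
  rw [map_add, map_smul, smul_eq_mul] at h1
  have h2 : J b (a + t • b) = t := by
    rw [map_add, map_smul, hJ.symm _ _ hab, hJ.apply_self, hb]; simp
  have h3 := StrongDual.abs_apply_le_norm (hJ.norm_le b) (a + t • b)
  rw [h2] at h3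
  have h4 := StrongDual.abs_apply_le_norm (hJ.norm_le (a + t • b)) (t • b)
  rw [map_smul, smul_eq_mul, norm_smul, hb, mul_one, Real.norm_eq_abs] at h4
  linarith [le_abs_self (t * J (a + t • b) b)]

theorem mul_apply_nonneg (hJ : IsSymmetricSupport J) {a b : Y} (ha : ‖a‖ = 1)
    (hab : J a b = 0) (t : ℝ) : 0 ≤ t * J (a + t • b) b := by
  have h1 := hJ.apply_self (a + t • b)
  rw [map_add, map_smul, smul_eq_mul] at h1
  have h3 := StrongDual.apply_le_norm (hJ.norm_le a) (a + t • b)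
  rw [hJ.apply_left_add ha hab] at h3
  have h4 := StrongDual.apply_le_norm (hJ.norm_le (a + t • b)) a
  linarith

theorem ratio_add (hJ : IsSymmetricSupport J) {a b c : Y} (ha : ‖a‖ = 1)
    (hc : ‖c‖ = 1) (hab : J a b = 0) (hac : J a c = 0) (hbc : J b c = 0) (s t : ℝ) :
    ratio J a b (s + t) = ratio J a b s + ratio J a b t := by
  have hcb := hJ.symm _ _ hbc
  have hca := hJ.symm _ _ hac
  have hba := hJ.symm _ _ hab
  set k := ratio J a c 1 with hk
  have hr := fun t => hJ.ratio_mul ha hab t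
  have hr' := fun t => hJ.ratio_mul hc hcb t
  have hA : ∀ t : ℝ, J (a + t • b + c) a ≠ 0 := fun t =>
    hJ.apply_ne_zero (by rw [map_add, hJ.apply_left_add ha hab, hac, add_zero])
  have h1 : ∀ t : ℝ, J (a + t • b + c) b = ratio J a b t * J (a + t • b + c) a := by
    intro t
    have : J (a + t • b + c) (b - ratio J a b t • a) = 0 := by
      apply hJ.add
      · rw [map_sub, map_smul, hr]; simp
      · rw [map_sub, map_smul, hcb, hca]; simp
    rw [map_sub, map_smul, smul_eq_mul] at this
    linarith
  have h2 : ∀ t : ℝ, J (a + t • b + c) b = ratio J c b t * J (a + t • b + c) c := by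
    intro t
    have : J (a + (c + t • b)) (b - ratio J c b t • c) = 0 := by
      apply hJ.add
      · rw [map_sub, map_smul, hab, hac]; simp
      · rw [map_sub, map_smul, hr']; simp
    rw [map_sub, map_smul, smul_eq_mul, show a + (c + t • b) = a + t • b + c by abel] at this
    linarith
  have h3 : ∀ t : ℝ, J (a + t • b + c) c = k * J (a + t • b + c) a := by
    intro t
    have : J ((a + (1 : ℝ) • c) + t • b) (c - k • a) = 0 := by
      apply hJ.add_smul
      · rw [map_sub, map_smul, hJ.ratio_mul ha hac]; simp [hk]
      · rw [map_sub, map_smul, hbc, hba]; simp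
    rw [map_sub, map_smul, smul_eq_mul,
      show (a + (1 : ℝ) • c) + t • b = a + t • b + c by rw [one_smul]; abel] at this
    linarith
  have h4 : J (a + (s + t) • b + c) b
      = ratio J a b s * J (a + (s + t) • b + c) a
        + ratio J c b t * J (a + (s + t) • b + c) c := by
    have : J ((a + s • b) + (c + t • b)) (b - ratio J a b s • a - ratio J c b t • c) = 0 := by
      apply hJ.add
      · rw [map_sub, map_sub, map_smul, map_smul, hr,
          hJ.symm c _ (by rw [map_add, map_smul, hca, hcb]; simp)]
        simp
      · rw [map_sub, map_sub, map_smul, map_smul, hr',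
          hJ.symm a _ (by rw [map_add, map_smul, hab, hac]; simp)]
        simp
    rw [map_sub, map_sub, map_smul, map_smul, smul_eq_mul, smul_eq_mul,
      show (a + s • b) + (c + t • b) = a + (s + t) • b + c by rw [_root_.add_smul]; abel] at this
    linarith
  have h5 : ratio J a b t = k * ratio J c b t := by
    apply mul_right_cancel₀ (hA t)
    rw [← h1, h2, h3]; ring
  apply mul_right_cancel₀ (hA (s + t))
  rw [← h1, h4, h3, h5]; ring

theorem ratio_eq (hJ : IsSymmetricSupport J) {a b c : Y} (ha : ‖a‖ = 1)
    (hb : ‖b‖ = 1) (hc : ‖c‖ = 1) (hab : J a b = 0) (hac : J a c = 0) (hbc : J b c = 0) (t : ℝ) :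
    ratio J a b t = ratio J a b 1 * t := by
  refine additive_eq_mul_of_mul_nonneg (hJ.ratio_add ha hc hab hac hbc) (fun t => ?_) t
  rw [ratio, mul_div_assoc']
  exact div_nonneg (hJ.mul_apply_nonneg ha hab t) (hJ.apply_nonneg hb hab t)

end IsSymmetricSupport

theorem eq_of_sub_sq_le {H M : ℝ → ℝ} {c : ℝ} (hc : 0 ≤ c) (hM : Monotone M)
    (hHM : ∀ t, H t ≤ M |t|)
    (hle : ∀ s t, H t - c * (s - t) ^ 2 * H t ≤ H s) (s t : ℝ) : H s = H t := by
  have hder : ∀ t, HasDerivAt H 0 t := by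
    intro t
    rw [hasDerivAt_iff_isLittleO]
    have hO : (fun s => H s - H t - (s - t) • (0 : ℝ)) =O[𝓝 t] fun s => (s - t) ^ 2 := by
      refine Asymptotics.IsBigO.of_bound (c * M (|t| + 1)) ?_
      filter_upwards [Metric.ball_mem_nhds t one_pos] with s hs
      rw [Metric.mem_ball, Real.dist_eq] at hs
      have hs' : |s| ≤ |t| + 1 := by
        have := abs_sub_abs_le_abs_sub s t
        linarith
      have h1 := (hHM s).trans (hM hs')
      have h2 := (hHM t).trans (hM (show |t| ≤ |t| + 1 by linarith))
      have h3 := hle s t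
      have h4 := hle t s
      have h5 : 0 ≤ c * (s - t) ^ 2 := by positivity
      have h6 := mul_le_mul_of_nonneg_left h1 h5
      have h7 := mul_le_mul_of_nonneg_left h2 h5
      have h8 : (t - s) ^ 2 = (s - t) ^ 2 := by ring
      rw [h8] at h4
      rw [smul_zero, sub_zero, Real.norm_eq_abs, Real.norm_eq_abs, abs_of_nonneg (sq_nonneg (s - t)),
        abs_le]
      constructor <;> linarith
    refine hO.trans_isLittleO ?_
    have : (fun s : ℝ => (s - t) ^ 2) = fun s => (s - t) * (s - t) := by
      ext s; ring
    rw [this]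
    have h0 : (fun s : ℝ => s - t) =o[𝓝 t] fun _ => (1 : ℝ) := by
      rw [Asymptotics.isLittleO_one_iff]
      have : Tendsto (fun s : ℝ => s - t) (𝓝 t) (𝓝 (t - t)) :=
        (continuous_id.sub continuous_const).tendsto t
      simpa using this
    simpa using h0.mul_isBigO (Asymptotics.isBigO_refl (fun s : ℝ => s - t) (𝓝 t))
  exact is_const_of_deriv_eq_zero (fun t => (hder t).differentiableAt)
    (fun t => (hder t).deriv) s t

namespace IsSymmetricSupport

variable {Y : Type*} [NormedAddCommGroup Y] [NormedSpace ℝ Y] {J : Y → StrongDual ℝ Y}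

theorem norm_sq_add_smul (hJ : IsSymmetricSupport J) {a b c : Y} (ha : ‖a‖ = 1)
    (hb : ‖b‖ = 1) (hc : ‖c‖ = 1) (hab : J a b = 0) (hac : J a c = 0) (hbc : J b c = 0) (t : ℝ) :
    ‖a + t • b‖ ^ 2 = 1 + t ^ 2 := by
  set κ := ratio J a b 1 with hκ
  have hκ0 : 0 ≤ κ :=
    div_nonneg (by simpa using hJ.mul_apply_nonneg ha hab 1) (hJ.apply_nonneg hb hab 1)
  have hden : ∀ t : ℝ, 0 < 1 + κ * t ^ 2 := fun t => by positivity
  have hB : ∀ t : ℝ, J (a + t • b) b = κ * t * J (a + t • b) a := fun t => by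
    rw [hJ.ratio_mul ha hab, hJ.ratio_eq ha hb hc hab hac hbc]
  have hself : ∀ t : ℝ, ‖a + t • b‖ = J (a + t • b) a * (1 + κ * t ^ 2) := fun t => by
    rw [← hJ.apply_self (a + t • b), map_add, map_smul, smul_eq_mul, hB]; ring
  have hsupp : ∀ s t : ℝ, J (a + t • b) a * (1 + κ * (s * t)) ≤ ‖a + s • b‖ := fun s t => by
    have := StrongDual.apply_le_norm (hJ.norm_le (a + t • b)) (a + s • b)
    rw [map_add, map_smul, smul_eq_mul, hB] at this
    linarith
  have hA := hJ.apply_nonneg hb hab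
  have hub : ∀ t : ℝ, ‖a + t • b‖ ≤ 1 + |t| := fun t => by
    refine (norm_add_le _ _).trans ?_
    rw [ha, norm_smul, hb, Real.norm_eq_abs, mul_one]
  have hconst := eq_of_sub_sq_le (H := fun t => ‖a + t • b‖ ^ 2 / (1 + κ * t ^ 2))
    (M := fun x => (1 + |max x 0|) ^ 2) (c := κ) hκ0 ?_ ?_ ?_
  · have hsq : ∀ t : ℝ, ‖a + t • b‖ ^ 2 = 1 + κ * t ^ 2 := by
      intro t
      have := hconst t 0
      simp only [zero_smul, add_zero, ha] at this
      rw [div_eq_iff (hden t).ne'] at this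
      rw [this]; norm_num
    have hlow : ∀ t : ℝ, 0 ≤ t → |‖a + t • b‖ - t| ≤ 1 := by
      intro t ht
      have := abs_norm_sub_norm_le (a + t • b) (t • b)
      rwa [add_sub_cancel_right, ha, norm_smul, hb, mul_one, Real.norm_of_nonneg ht] at this
    have h1 : κ = 1 := by
      apply le_antisymm
      · by_contra! h
        have h2 := hsq (2 / (κ - 1) + 1)
        have hp : 0 < κ - 1 := by linarith
        have h3 := hlow (2 / (κ - 1) + 1) (by positivity)
        set T := 2 / (κ - 1) + 1 with hT
        have h4 : (κ - 1) * T = 2 + (κ - 1) := by rw [hT]; field_simp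
        have hT0 : 0 < T := by positivity
        rw [abs_le] at h3
        have h5 : ‖a + T • b‖ ^ 2 ≤ (1 + T) ^ 2 :=
          pow_le_pow_left₀ (norm_nonneg _) (by linarith) 2
        nlinarith
      · by_contra! h
        have h2 := hsq (2 / (1 - κ) + 1)
        have hp : 0 < 1 - κ := by linarith
        have h3 := hlow (2 / (1 - κ) + 1) (by positivity)
        set T := 2 / (1 - κ) + 1 with hT
        have h4 : (1 - κ) * T = 2 + (1 - κ) := by rw [hT]; field_simp
        have hT0 : 0 < T := by positivity
        have hT1 : 1 ≤ T := by
          have : 0 < 2 / (1 - κ) := by positivity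
          linarith
        rw [abs_le] at h3
        have h5 : (T - 1) ^ 2 ≤ ‖a + T • b‖ ^ 2 :=
          pow_le_pow_left₀ (by linarith) (by linarith) 2
        nlinarith
    rw [hsq, h1, one_mul]
  · intro x y hxy
    have h1 : max x 0 ≤ max y 0 := max_le_max_right 0 hxy
    have h2 : (0 : ℝ) ≤ max x 0 := le_max_right _ _
    simp only [abs_of_nonneg h2, abs_of_nonneg (h2.trans h1)]
    gcongr
  · intro t
    have h1 := hub t
    rw [max_eq_left (abs_nonneg t), abs_abs]
    refine (div_le_self (by positivity) ?_).trans (pow_le_pow_left₀ (norm_nonneg _) h1 2)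
    have : 0 ≤ κ * t ^ 2 := by positivity
    linarith
  · intro s t
    have hid : (1 + κ * (s * t)) ^ 2 = (1 + κ * s ^ 2) * (1 + κ * t ^ 2) - κ * (s - t) ^ 2 := by
      ring
    have hHt : ‖a + t • b‖ ^ 2 / (1 + κ * t ^ 2) = J (a + t • b) a ^ 2 * (1 + κ * t ^ 2) := by
      rw [hself, div_eq_iff (hden t).ne']; ring
    have hks : 0 ≤ κ * s ^ 2 := by positivity
    have hkt : 0 ≤ κ * t ^ 2 := by positivity
    have hkst : 0 ≤ κ * (s - t) ^ 2 := by positivity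
    have hA2 : 0 ≤ J (a + t • b) a ^ 2 := sq_nonneg _
    simp only [hHt]
    by_cases h : 0 ≤ 1 + κ * (s * t)
    · rw [le_div_iff₀ (hden s)]
      have h1 : (J (a + t • b) a * (1 + κ * (s * t))) ^ 2 ≤ ‖a + s • b‖ ^ 2 :=
        pow_le_pow_left₀ (mul_nonneg (hA t) h) (hsupp s t) 2
      rw [mul_pow, hid] at h1
      refine le_trans ?_ h1
      have h2 : 1 ≤ (1 + κ * s ^ 2) * (1 + κ * t ^ 2) := by nlinarith
      have h3 := mul_nonneg hA2 (mul_nonneg hkst (sub_nonneg.mpr h2))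
      linarith
    · push Not at h
      have h1 : 1 ≤ κ * (s - t) ^ 2 := by nlinarith
      have h2 : 0 ≤ ‖a + s • b‖ ^ 2 / (1 + κ * s ^ 2) := div_nonneg (sq_nonneg _) (hden s).le
      have h3 : 0 ≤ J (a + t • b) a ^ 2 * (1 + κ * t ^ 2) := mul_nonneg hA2 (hden t).le
      nlinarith

theorem norm_sq_smul_add_smul (hJ : IsSymmetricSupport J) {a b c : Y} (ha : ‖a‖ = 1)
    (hb : ‖b‖ = 1) (hc : ‖c‖ = 1) (hab : J a b = 0) (hac : J a c = 0) (hbc : J b c = 0)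
    (s t : ℝ) : ‖s • a + t • b‖ ^ 2 = s ^ 2 + t ^ 2 := by
  by_cases hs : s = 0
  · simp [hs, norm_smul, hb]
  · have h1 : s • a + t • b = s • (a + (t / s) • b) := by
      rw [smul_add, smul_smul, mul_div_cancel₀ _ hs]
    rw [h1, norm_smul, mul_pow, hJ.norm_sq_add_smul ha hb hc hab hac hbc, Real.norm_eq_abs, sq_abs]
    field_simp

theorem parallelogram (hJ : IsSymmetricSupport J) (hY : ¬ FiniteDimensional ℝ Y) (x y : Y) :
    ‖x + y‖ * ‖x + y‖ + ‖x - y‖ * ‖x - y‖ = 2 * (‖x‖ * ‖x‖ + ‖y‖ * ‖y‖) := by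
  by_cases hx : x = 0
  · simp [hx]; ring
  set a := ‖x‖⁻¹ • x with hadef
  have ha : ‖a‖ = 1 := by
    rw [hadef, norm_smul, norm_inv, norm_norm, inv_mul_cancel₀ (norm_ne_zero_iff.mpr hx)]
  have hxa : x = ‖x‖ • a := by
    rw [hadef, smul_smul, mul_inv_cancel₀ (norm_ne_zero_iff.mpr hx), one_smul]
  set w := y - J a y • a with hw
  have haw : J a w = 0 := by
    rw [hw, map_sub, map_smul, hJ.apply_self, ha]; simp
  have hyw : y = J a y • a + w := by rw [hw]; abel
  set α := ‖x‖
  set β := J a y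
  by_cases hw0 : w = 0
  · rw [hyw, hw0, add_zero, hxa, ← _root_.add_smul, ← sub_smul]
    simp only [norm_smul, ha, mul_one, Real.norm_eq_abs, abs_mul_abs_self]
    ring
  obtain ⟨b, γ, hb, hwb⟩ : ∃ (b : Y) (γ : ℝ), ‖b‖ = 1 ∧ w = γ • b := by
    refine ⟨‖w‖⁻¹ • w, ‖w‖, ?_, ?_⟩
    · rw [norm_smul, norm_inv, norm_norm, inv_mul_cancel₀ (norm_ne_zero_iff.mpr hw0)]
    · rw [smul_smul, mul_inv_cancel₀ (norm_ne_zero_iff.mpr hw0), one_smul]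
  have hab : J a b = 0 := by
    rw [hwb, map_smul, smul_eq_mul] at haw
    refine (mul_eq_zero.mp haw).resolve_left fun h => hw0 ?_
    rw [hwb, h, zero_smul]
  obtain ⟨c, hc, hac, hbc⟩ : ∃ c : Y, ‖c‖ = 1 ∧ J a c = 0 ∧ J b c = 0 := by
    have hni : ¬ Function.Injective ((J a : Y →ₗ[ℝ] ℝ).prod (J b : Y →ₗ[ℝ] ℝ)) := fun h =>
      hY (FiniteDimensional.of_injective _ h)
    rw [← LinearMap.ker_eq_bot, Submodule.eq_bot_iff] at hni
    push Not at hni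
    obtain ⟨c, hc, hc0⟩ := hni
    have h1 : J a c = 0 ∧ J b c = 0 := by simpa using hc
    refine ⟨‖c‖⁻¹ • c, ?_, ?_, ?_⟩
    · rw [norm_smul, norm_inv, norm_norm, inv_mul_cancel₀ (norm_ne_zero_iff.mpr hc0)]
    · rw [map_smul, h1.1, smul_zero]
    · rw [map_smul, h1.2, smul_zero]
  have key := hJ.norm_sq_smul_add_smul ha hb hc hab hac hbc
  have h1 : x + y = (α + β) • a + γ • b := by rw [hyw, hwb, hxa]; module
  have h2 : x - y = (α - β) • a + (-γ) • b := by rw [hyw, hwb, hxa]; module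
  have h3 : ‖y‖ ^ 2 = β ^ 2 + γ ^ 2 := by rw [← key, hyw, hwb]
  rw [h1, h2, ← sq, ← sq, ← sq, ← sq, key, key, h3]
  ring

end IsSymmetricSupport

/-- Let the vectors of a finite-dimensional space act faithfully as functionals on `Z`. If the
vectors conjugate to a fixed one under isometries of `Z` are dense in the unit sphere, then the
norm satisfies the parallelogram law. -/
theorem innerProductSpaceable_of_dense_conjugates {V Z : Type*} [NormedAddCommGroup V]
    [NormedSpace ℝ V] [NormedAddCommGroup Z] [NormedSpace ℝ Z] [FiniteDimensional ℝ V]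
    [FiniteDimensional ℝ Z] (B : V →L[ℝ] StrongDual ℝ Z) (hB : Function.Injective B) (v₀ : V)
    (h : ∀ v : V, ‖v‖ = 1 → ∀ ε > 0, ∃ v' : V, ‖v - v'‖ < ε ∧
      ∃ T : Z ≃ₗᵢ[ℝ] Z, ∀ z, B v' z = B v₀ (T z)) :
    InnerProductSpaceable V := by
  borelize Z
  have := FiniteDimensional.proper_real Z
  have := FiniteDimensional.proper_real V
  let μ : MeasureTheory.Measure Z := MeasureTheory.Measure.hausdorffMeasure (Module.finrank ℝ Z)
  have hμ : μ.IsAddHaarMeasure := MeasureTheory.isAddHaarMeasure_hausdorffMeasure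
  let K : Set Z := Metric.closedBall 0 1
  have hK : IsCompact K := isCompact_closedBall 0 1
  let q : V → ℝ := fun v => ∫ z in K, (B v z) ^ 2 ∂μ
  have hint : ∀ v w, MeasureTheory.IntegrableOn (fun z => B v z * B w z) K μ := fun v w =>
    ((B v).continuous.mul (B w).continuous).continuousOn.integrableOn_compact hK
  have hint2 : ∀ v, MeasureTheory.IntegrableOn (fun z => B v z ^ 2) K μ := fun v => by
    simpa [sq] using hint v v
  have hcont : Continuous q := by
    refine continuous_parametric_integral_of_continuous (f := fun v z => (B v z) ^ 2) ?_ hK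
    simp only [Function.uncurry_def]
    fun_prop
  have hpar : ∀ v w, q (v + w) + q (v - w) = 2 * (q v + q w) := by
    intro v w
    simp only [q]
    rw [← MeasureTheory.integral_add (hint2 _) (hint2 _),
      ← MeasureTheory.integral_add (hint2 _) (hint2 _), ← MeasureTheory.integral_const_mul]
    congr 1
    ext z
    simp only [map_add, map_sub, add_apply, sub_apply]
    ring
  have hsmul : ∀ (c : ℝ) v, q (c • v) = c ^ 2 * q v := by
    intro c v
    simp only [q]
    rw [← MeasureTheory.integral_const_mul]
    congr 1
    ext z
    simp only [map_smul, smul_apply, smul_eq_mul]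
    ring
  have hpos : ∀ v, v ≠ 0 → 0 < q v := by
    intro v hv
    simp only [q]
    rw [MeasureTheory.setIntegral_pos_iff_support_of_nonneg_ae
      (Eventually.of_forall fun z => sq_nonneg _) (hint2 v)]
    obtain ⟨z, hz⟩ : ∃ z, B v z ≠ 0 := by
      by_contra! h0
      exact hv (hB (by rw [map_zero]; ext z; exact h0 z))
    have hopen : IsOpen (Function.support (fun z => B v z ^ 2) ∩ Metric.ball 0 1) :=
      (((B v).continuous.pow 2).isOpen_support).inter Metric.isOpen_ball
    refine (hopen.measure_pos μ ⟨(2 * (‖z‖ + 1))⁻¹ • z, ?_, ?_⟩).trans_le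
      (MeasureTheory.measure_mono
        (Set.inter_subset_inter_right _ Metric.ball_subset_closedBall))
    · have : (2 * (‖z‖ + 1)) ≠ 0 := by positivity
      simp [hz]
      positivity
    · rw [mem_ball_zero_iff, norm_smul, Real.norm_of_nonneg (by positivity),
        inv_mul_lt_iff₀ (by positivity)]
      linarith [norm_nonneg z]
  have hinv : ∀ v (T : Z ≃ₗᵢ[ℝ] Z), (∀ z, B v z = B v₀ (T z)) → q v = q v₀ := by
    intro v T hT
    have h1 := (T.toIsometryEquiv.measurePreserving_hausdorffMeasure
      (Module.finrank ℝ Z)).setIntegral_preimage_emb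
      T.toHomeomorph.measurableEmbedding (fun z => B v₀ z ^ 2) K
    have h2 : T.toIsometryEquiv ⁻¹' K = K := by
      ext z; simp [K]
    rw [h2] at h1
    simp only [q, hT]
    exact h1
  have hunit : ∀ v, ‖v‖ = 1 → q v = q v₀ := by
    intro v hv
    have hcl : IsClosed {w | q w = q v₀} := isClosed_eq hcont continuous_const
    refine hcl.closure_subset (Metric.mem_closure_iff.mpr fun ε hε => ?_)
    obtain ⟨v', h1, T, hT⟩ := h v hv ε hε
    exact ⟨v', hinv v' T hT, by rwa [dist_eq_norm]⟩
  have hq : ∀ v, q v = ‖v‖ ^ 2 * q v₀ := by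
    intro v
    by_cases hv : v = 0
    · have := hsmul 0 v
      simp [hv] at this ⊢
      exact this
    · have hn : ‖v‖ ≠ 0 := norm_ne_zero_iff.mpr hv
      rw [← hunit (‖v‖⁻¹ • v) (by rw [norm_smul, norm_inv, norm_norm, inv_mul_cancel₀ hn]), hsmul]
      field_simp
  refine ⟨fun v w => ?_⟩
  by_cases h0 : q v₀ = 0
  · have hz : ∀ v : V, v = 0 := by
      intro v
      by_contra hv
      have := hpos v hv
      rw [hq, h0, mul_zero] at this
      exact this.false
    simp [hz v, hz w]
  · have := hpar v w
    rw [hq (v + w), hq (v - w), hq v, hq w] at this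
    apply mul_right_cancel₀ h0
    linarith

theorem InnerProductSpaceable.of_strongDual {X : Type*} [NormedAddCommGroup X] [NormedSpace ℝ X]
    (h : InnerProductSpaceable (StrongDual ℝ X)) : InnerProductSpaceable X := by
  have hle : ∀ x y : X, ‖x + y‖ ^ 2 + ‖x - y‖ ^ 2 ≤ 2 * (‖x‖ ^ 2 + ‖y‖ ^ 2) := by
    intro x y
    obtain ⟨f, hf1, hf2⟩ := exists_dual_vector'' ℝ (x + y)
    obtain ⟨g, hg1, hg2⟩ := exists_dual_vector'' ℝ (x - y)
    simp only [RCLike.ofReal_real_eq_id, id] at hf2 hg2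
    set a := ‖x + y‖
    set b := ‖x - y‖
    have h1 : a ^ 2 + b ^ 2 = (a • f + b • g) x + (a • f - b • g) y := by
      rw [map_add] at hf2
      rw [map_sub] at hg2
      simp only [add_apply, sub_apply,
        smul_apply, smul_eq_mul]
      linear_combination (-a) * hf2 - b * hg2
    have h2 := (le_abs_self _).trans ((a • f + b • g).le_opNorm x)
    have h3 := (le_abs_self _).trans ((a • f - b • g).le_opNorm y)
    have h4 := h.parallelogram_identity (a • f) (b • g)
    have h5 : ‖a • f‖ ≤ a := by
      rw [norm_smul, norm_norm]; exact mul_le_of_le_one_right (norm_nonneg _) hf1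
    have h6 : ‖b • g‖ ≤ b := by
      rw [norm_smul, norm_norm]; exact mul_le_of_le_one_right (norm_nonneg _) hg1
    have h7 : ‖a • f‖ * ‖a • f‖ ≤ a * a :=
      mul_self_le_mul_self (norm_nonneg _) h5
    have h8 : ‖b • g‖ * ‖b • g‖ ≤ b * b :=
      mul_self_le_mul_self (norm_nonneg _) h6
    set c := ‖a • f + b • g‖
    set d := ‖a • f - b • g‖
    nlinarith [sq_nonneg (c - 2 * ‖x‖), sq_nonneg (d - 2 * ‖y‖)]
  refine ⟨fun x y => ?_⟩
  have h1 := hle x y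
  have h2 := hle (x + y) (x - y)
  have h3 : x + y + (x - y) = (2 : ℝ) • x := by module
  have h4 : x + y - (x - y) = (2 : ℝ) • y := by module
  rw [h3, h4, norm_smul, norm_smul, Real.norm_of_nonneg zero_le_two] at h2
  linarith

theorem InnerProductSpaceable.isIsometricallyHilbert {X : Type*} [NormedAddCommGroup X]
    [NormedSpace ℝ X] [CompleteSpace X] (h : InnerProductSpaceable X) :
    IsIsometricallyHilbert X := by
  let I : InnerProductSpace ℝ X := InnerProductSpace.ofNorm ℝ h.parallelogram_identity
  refine ⟨X, inferInstance, I, inferInstance, ⟨LinearIsometryEquiv.refl ℝ X⟩⟩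

theorem StrongDual.norm_le_of_apply_le {X : Type*} [NormedAddCommGroup X] [NormedSpace ℝ X]
    {f : StrongDual ℝ X} {C : ℝ} (hC : 0 ≤ C) (h : ∀ x, f x ≤ C * ‖x‖) : ‖f‖ ≤ C := by
  refine f.opNorm_le_bound hC fun x => ?_
  rw [Real.norm_eq_abs, abs_le]
  have := h (-x)
  rw [map_neg, norm_neg] at this
  exact ⟨by linarith, h x⟩

namespace IsBicontractivePair

variable {Y : Type*} [NormedAddCommGroup Y] [NormedSpace ℝ Y] {v w : Y} {φ ψ : StrongDual ℝ Y}

/-- Iterating the product of the complementary projections of two bicontractive pairs. -/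
theorem norm_iterate_le (hv : IsBicontractivePair v φ) (hw : IsBicontractivePair w ψ) (z : Y)
    (n : ℕ) :
    ‖(z - ψ z • w) - ((φ z - ψ z * φ w) * ∑ i ∈ Finset.range n, (φ w * ψ v) ^ i) • (v - ψ v • w)‖
      ≤ ‖z‖ := by
  induction n with
  | zero => simpa using hw.norm_compl_le z
  | succ n ih =>
    set d := φ z - ψ z * φ w with hd
    set s := ∑ i ∈ Finset.range n, (φ w * ψ v) ^ i with hs
    set y := (z - ψ z • w) - (d * s) • (v - ψ v • w) with hy
    have hgeom : s * (1 - φ w * ψ v) = 1 - (φ w * ψ v) ^ n := geom_sum_mul_neg _ _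
    have h1 : φ y = d * (φ w * ψ v) ^ n := by
      simp only [hy, map_sub, map_smul, smul_eq_mul, hv.apply_self]
      linear_combination (-d) * hgeom - hd
    have h2 : ψ y = 0 := by
      simp only [hy, map_sub, map_smul, smul_eq_mul, hw.apply_self]
      ring
    have h3 := (hw.norm_compl_le (y - φ y • v)).trans ((hv.norm_compl_le y).trans ih)
    refine le_of_eq_of_le (congrArg norm ?_) h3
    have h4 : ψ (y - φ y • v) = -(d * (φ w * ψ v) ^ n * ψ v) := by
      rw [map_sub, map_smul, h2, h1, smul_eq_mul, zero_sub]
    rw [Finset.sum_range_succ, h4, h1, hy]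
    module

theorem abs_sub_mul_norm_sub_le (hv : IsBicontractivePair v φ) (hw : IsBicontractivePair w ψ)
    (ha : 0 ≤ φ w) (hb : 0 ≤ ψ v) (z : Y) :
    |φ z - ψ z * φ w| * ‖v - ψ v • w‖ ≤ 2 * (1 - φ w * ψ v) * ‖z‖ := by
  have ha1 : φ w ≤ 1 := hw.norm_vec ▸ StrongDual.apply_le_norm hv.norm_le w
  have hb1 : ψ v ≤ 1 := hv.norm_vec ▸ StrongDual.apply_le_norm hw.norm_le v
  have hl0 : 0 ≤ φ w * ψ v := mul_nonneg ha hb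
  have hl1 : φ w * ψ v ≤ 1 := mul_le_one₀ ha1 hb hb1
  have hstep : ∀ n : ℕ, (|φ z - ψ z * φ w| * ‖v - ψ v • w‖) *
      ∑ i ∈ Finset.range n, (φ w * ψ v) ^ i ≤ 2 * ‖z‖ := by
    intro n
    have h1 := hv.norm_iterate_le hw z n
    have h2 := hw.norm_compl_le z
    have h3 := norm_le_norm_add_norm_sub (z - ψ z • w)
      (((φ z - ψ z * φ w) * ∑ i ∈ Finset.range n, (φ w * ψ v) ^ i) • (v - ψ v • w))
    have h4 : 0 ≤ ∑ i ∈ Finset.range n, (φ w * ψ v) ^ i :=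
      Finset.sum_nonneg fun i _ => pow_nonneg hl0 i
    rw [norm_smul, norm_mul, Real.norm_of_nonneg h4, Real.norm_eq_abs] at h3
    linarith
  set D := |φ z - ψ z * φ w| * ‖v - ψ v • w‖ with hD
  set l := φ w * ψ v
  rcases hl1.lt_or_eq with hlt | heq
  · have h1 : ∀ n : ℕ, D * (1 - l ^ n) ≤ 2 * (1 - l) * ‖z‖ := by
      intro n
      rw [← geom_sum_mul_neg]
      have := mul_le_mul_of_nonneg_right (hstep n) (sub_nonneg.mpr hl1)
      linarith
    have h2 : Tendsto (fun n : ℕ => D * (1 - l ^ n)) atTop (𝓝 (D * (1 - 0))) :=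
      ((tendsto_pow_atTop_nhds_zero_of_lt_one hl0 hlt).const_sub 1).const_mul D
    simpa using le_of_tendsto' h2 h1
  · rw [heq] at hstep ⊢
    simp only [one_pow, Finset.sum_const, Finset.card_range, nsmul_eq_mul, mul_one] at hstep
    rw [sub_self, mul_zero, zero_mul]
    by_contra! hpos
    obtain ⟨n, hn⟩ := exists_nat_gt (2 * ‖z‖ / D)
    rw [div_lt_iff₀ hpos] at hn
    linarith [hstep n]

theorem norm_sub_lt_or_norm_sub_lt {ε : ℝ} (hε : 0 < ε) :
    ∃ δ > 0, ∀ (v w : Y) (φ ψ : StrongDual ℝ Y), IsBicontractivePair v φ →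
      IsBicontractivePair w ψ → 1 - δ < φ w → 1 - δ < ψ v → ‖v - w‖ < ε ∨ ‖φ - ψ‖ < ε := by
  refine ⟨min 1 (min (ε / 2) (ε ^ 2 / 32)), by positivity, ?_⟩
  intro v w φ ψ hv hw ha hb
  set δ := min 1 (min (ε / 2) (ε ^ 2 / 32)) with hδ
  have hδ1 : δ ≤ 1 := min_le_left _ _
  have hδ2 : δ ≤ ε / 2 := (min_le_right _ _).trans (min_le_left _ _)
  have hδ3 : δ ≤ ε ^ 2 / 32 := (min_le_right _ _).trans (min_le_right _ _)
  have ha1 : φ w ≤ 1 := hw.norm_vec ▸ StrongDual.apply_le_norm hv.norm_le w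
  have hb1 : ψ v ≤ 1 := hv.norm_vec ▸ StrongDual.apply_le_norm hw.norm_le v
  have ha0 : 0 ≤ φ w := by linarith
  have hb0 : 0 ≤ ψ v := by linarith
  by_contra! hcon
  obtain ⟨h1, h2⟩ := hcon
  have h3 : ε / 2 ≤ ‖v - ψ v • w‖ := by
    have h := norm_sub_le_norm_sub_add_norm_sub v (ψ v • w) w
    have h' : ‖ψ v • w - w‖ = 1 - ψ v := by
      rw [show ψ v • w - w = (ψ v - 1) • w by module, norm_smul, hw.norm_vec, mul_one,
        Real.norm_eq_abs, abs_sub_comm, abs_of_nonneg (by linarith)]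
    linarith
  have h4 : ‖φ - φ w • ψ‖ ≤ 2 * (1 - φ w * ψ v) / ‖v - ψ v • w‖ := by
    refine StrongDual.norm_le_of_apply_le (div_nonneg ?_ (norm_nonneg _)) fun z => ?_
    · nlinarith
    · rw [div_mul_eq_mul_div, le_div_iff₀ (by linarith)]
      refine le_trans ?_ (hv.abs_sub_mul_norm_sub_le hw ha0 hb0 z)
      refine mul_le_mul_of_nonneg_right ?_ (norm_nonneg _)
      refine le_trans (le_of_eq ?_) (le_abs_self _)
      simp only [sub_apply, smul_apply, smul_eq_mul]
      ring
  have h5 : ε / 2 ≤ ‖φ - φ w • ψ‖ := by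
    have h := norm_sub_le_norm_sub_add_norm_sub φ (φ w • ψ) ψ
    have h' : ‖φ w • ψ - ψ‖ ≤ 1 - φ w := by
      rw [show φ w • ψ - ψ = (φ w - 1) • ψ by module, norm_smul, Real.norm_eq_abs, abs_sub_comm,
        abs_of_nonneg (by linarith)]
      exact mul_le_of_le_one_right (by linarith) hw.norm_le
    linarith
  rw [le_div_iff₀ (by linarith)] at h4
  have h6 : ε / 2 * (ε / 2) ≤ ‖φ - φ w • ψ‖ * ‖v - ψ v • w‖ :=
    mul_le_mul h5 h3 (by linarith) (norm_nonneg _)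
  nlinarith

end IsBicontractivePair

/-- A form of the Banach-Alaoglu theorem for sequences of functionals. -/
theorem exists_ultrafilter_tendsto_apply {Y : Type*} [NormedAddCommGroup Y] [NormedSpace ℝ Y]
    (ψ : ℕ → StrongDual ℝ Y) (hψ : ∀ n, ‖ψ n‖ ≤ 1) :
    ∃ (𝒰 : Ultrafilter ℕ) (g : StrongDual ℝ Y), (𝒰 : Filter ℕ) ≤ atTop ∧ ‖g‖ ≤ 1 ∧
      ∀ y, Tendsto (fun n => ψ n y) 𝒰 (𝓝 (g y)) := by
  let 𝒰 : Ultrafilter ℕ := Ultrafilter.of atTop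
  obtain ⟨g, hg, hlim⟩ := (WeakDual.isCompact_closedBall (𝕜 := ℝ) (E := Y) 0 1).ultrafilter_le_nhds
    (𝒰.map fun n => StrongDual.toWeakDual (ψ n)) (by
      rw [Ultrafilter.coe_map, le_principal_iff, mem_map]
      refine Eventually.of_forall fun n => ?_
      rw [Set.mem_preimage, mem_closedBall_zero_iff]
      exact hψ n)
  rw [Set.mem_preimage, mem_closedBall_zero_iff] at hg
  refine ⟨𝒰, WeakDual.toStrongDual g, Ultrafilter.of_le _, hg, fun y => ?_⟩
  exact tendsto_iff_forall_eval_tendsto_topDualPairing.mp hlim y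

theorem exists_isBicontractivePair_of_dense {Y : Type*} [NormedAddCommGroup Y] [NormedSpace ℝ Y]
    {y : Y} (hy : ‖y‖ = 1)
    (h : ∀ ε > 0, ∃ (v : Y) (φ : StrongDual ℝ Y), IsBicontractivePair v φ ∧ ‖y - v‖ < ε) :
    ∃ ψ : StrongDual ℝ Y, IsBicontractivePair y ψ := by
  choose v φ hp hlt using fun n : ℕ => h (1 / ((n : ℝ) + 1)) (by positivity)
  obtain ⟨𝒰, g, h𝒰, hg, hlim⟩ := exists_ultrafilter_tendsto_apply φ fun n => (hp n).norm_le
  have hv : Tendsto v 𝒰 (𝓝 y) := by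
    refine Tendsto.mono_left ?_ h𝒰
    rw [tendsto_iff_norm_sub_tendsto_zero]
    refine squeeze_zero (fun _ => norm_nonneg _) (fun n => ?_)
      tendsto_one_div_add_atTop_nhds_zero_nat
    rw [norm_sub_rev]
    exact (hlt n).le
  refine ⟨g, hy, hg, ?_, fun z => ?_⟩
  · have h1 : Tendsto (fun n => φ n y - 1) 𝒰 (𝓝 0) := by
      have h2 : Tendsto (fun n => ‖v n - y‖) 𝒰 (𝓝 0) := tendsto_iff_norm_sub_tendsto_zero.mp hv
      refine squeeze_zero_norm (fun n => ?_) h2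
      rw [← (hp n).apply_self, ← map_sub, Real.norm_eq_abs, norm_sub_rev]
      exact StrongDual.abs_apply_le_norm (hp n).norm_le _
    have h3 := tendsto_nhds_unique h1 ((hlim y).sub_const 1)
    linarith
  · exact le_of_tendsto' (tendsto_const_nhds.sub ((hlim z).smul hv)).norm
      fun n => (hp n).norm_compl_le z

theorem exists_isBicontractivePair_dual_of_tendsto {X : Type*} [NormedAddCommGroup X]
    [NormedSpace ℝ X] {f : StrongDual ℝ X} (hf : ‖f‖ = 1) (w : ℕ → X) (φ : ℕ → StrongDual ℝ X)
    (hp : ∀ n, IsBicontractivePair (w n) (φ n))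
    (hφ : ∀ x, Tendsto (fun n => φ n x) atTop (𝓝 (f x)))
    (hw : Tendsto (fun n => f (w n)) atTop (𝓝 1)) :
    ∃ ψ : StrongDual ℝ (StrongDual ℝ X), IsBicontractivePair f ψ := by
  obtain ⟨𝒰, g, h𝒰, hg, hlim⟩ := exists_ultrafilter_tendsto_apply
    (fun n => NormedSpace.inclusionInDoubleDual ℝ X (w n))
    (fun n => (NormedSpace.double_dual_bound ℝ X (w n)).trans (hp n).norm_vec.le)
  simp only [NormedSpace.dual_def] at hlim
  refine ⟨g, hf, hg, tendsto_nhds_unique (hlim f) (hw.mono_left h𝒰), fun h => ?_⟩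
  refine StrongDual.norm_le_of_apply_le (norm_nonneg _) fun x => ?_
  have h1 : Tendsto (fun n => h x - h (w n) * φ n x) 𝒰 (𝓝 (h x - g h * f x)) :=
    tendsto_const_nhds.sub ((hlim h).mul ((hφ x).mono_left h𝒰))
  refine le_of_tendsto' h1 fun n => ?_
  have h2 : h x - h (w n) * φ n x = h (x - φ n x • w n) := by
    rw [map_sub, map_smul, smul_eq_mul, mul_comm]
  rw [h2]
  refine (le_abs_self _).trans ((h.le_opNorm _).trans ?_)
  exact mul_le_mul_of_nonneg_left ((hp n).norm_compl_le x) (norm_nonneg _)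

/-- The action of a surjective linear isometry on functionals. -/
noncomputable def dualRotation {X : Type*} [NormedAddCommGroup X] [NormedSpace ℝ X]
    (T : X ≃ₗᵢ[ℝ] X) (f : StrongDual ℝ X) : StrongDual ℝ X :=
  f.comp (T.symm.toContinuousLinearEquiv : X →L[ℝ] X)

section

variable {X : Type*} [NormedAddCommGroup X] [NormedSpace ℝ X]

@[simp]
theorem dualRotation_apply (T : X ≃ₗᵢ[ℝ] X) (f : StrongDual ℝ X) (x : X) :
    dualRotation T f x = f (T.symm x) :=
  rfl

theorem norm_dualRotation (T : X ≃ₗᵢ[ℝ] X) (f : StrongDual ℝ X) : ‖dualRotation T f‖ = ‖f‖ :=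
  f.opNorm_comp_linearIsometryEquiv T.symm

theorem IsBicontractivePair.rotate {u : X} {p : StrongDual ℝ X} (h : IsBicontractivePair u p)
    (T : X ≃ₗᵢ[ℝ] X) : IsBicontractivePair (T u) (dualRotation T p) where
  norm_vec := by rw [T.norm_map, h.norm_vec]
  norm_le := by rw [norm_dualRotation]; exact h.norm_le
  apply_self := by simp [h.apply_self]
  norm_compl_le z := by
    have := h.norm_compl_le (T.symm z)
    rw [T.symm.norm_map] at this
    rw [← T.symm.norm_map]
    simpa using this

theorem norm_add_rotation (S T : X ≃ₗᵢ[ℝ] X) (u : X) :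
    ‖u + (T.trans S.symm) u‖ = ‖S u + T u‖ := by
  rw [← S.norm_map]; simp

theorem norm_sub_rotation (S T : X ≃ₗᵢ[ℝ] X) (u : X) :
    ‖u - (T.trans S.symm) u‖ = ‖S u - T u‖ := by
  rw [← S.norm_map]; simp

theorem norm_sub_dualRotation (S T : X ≃ₗᵢ[ℝ] X) (p : StrongDual ℝ X) :
    ‖p - dualRotation (T.trans S.symm) p‖ = ‖dualRotation S p - dualRotation T p‖ := by
  rw [← norm_dualRotation S]
  congr 1
  ext x
  simp

theorem IsBicontractiveProjectionOnto.exists_isBicontractivePair {u : X} (hu : ‖u‖ = 1)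
    {P : X →L[ℝ] X} (hP : IsBicontractiveProjectionOnto P u) :
    ∃ p : StrongDual ℝ X, IsBicontractivePair u p ∧ ∀ x, P x = p x • u := by
  obtain ⟨f, hf, hfu⟩ := exists_dual_vector'' ℝ u
  rw [hu] at hfu
  simp only [RCLike.ofReal_real_eq_id, id] at hfu
  have hPx : ∀ x, P x = f (P x) • u := by
    intro x
    have : P x ∈ Submodule.span ℝ {u} := by
      rw [← hP.range_eq]; exact ⟨x, rfl⟩
    obtain ⟨c, hc⟩ := Submodule.mem_span_singleton.mp this
    rw [← hc, map_smul, hfu, smul_eq_mul, mul_one]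
  have hPu : P u = u := by
    have : u ∈ LinearMap.range (P : X →ₗ[ℝ] X) := by
      rw [hP.range_eq]; exact Submodule.mem_span_singleton_self u
    obtain ⟨z, hz⟩ := this
    rw [← hz]
    exact hP.idem z
  refine ⟨f.comp P, ⟨hu, ?_, ?_, fun z => ?_⟩, hPx⟩
  · refine (f.opNorm_comp_le P).trans ?_
    rw [hP.norm_eq, mul_one]
    exact hf
  · rw [ContinuousLinearMap.comp_apply, hPu, hfu]
  · rw [ContinuousLinearMap.comp_apply, ← hPx]
    have := (ContinuousLinearMap.id ℝ X - P).le_opNorm z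
    rw [hP.norm_compl_eq, one_mul] at this
    simpa using this

theorem IsBigPoint.closedBall_subset {u : X} (hu : IsBigPoint u) {C : Set X} (hC : IsClosed C)
    (hconv : Convex ℝ C) (h : ∀ T : X ≃ₗᵢ[ℝ] X, T u ∈ C) : Metric.closedBall 0 1 ⊆ C := by
  rw [← hu.2]
  refine closure_minimal (convexHull_min ?_ hconv) hC
  rintro _ ⟨T, rfl⟩
  exact h T

theorem IsBigPoint.exists_lt_apply {u : X} (hu : IsBigPoint u) (f : StrongDual ℝ X) {ε : ℝ}
    (hε : 0 < ε) : ∃ T : X ≃ₗᵢ[ℝ] X, ‖f‖ - ε < f (T u) := by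
  by_contra! h
  have hsub := hu.closedBall_subset (C := {x | f x ≤ ‖f‖ - ε})
    (isClosed_le f.continuous continuous_const)
    (convex_halfSpace_le f.toLinearMap.isLinear _) h
  have h0 : (0 : ℝ) ≤ ‖f‖ - ε := by
    have := hsub (show (0 : X) ∈ Metric.closedBall 0 1 by simp)
    simpa using this
  have : ‖f‖ ≤ ‖f‖ - ε := by
    refine StrongDual.norm_le_of_apply_le h0 fun x => ?_
    by_cases hx : x = 0
    · simp [hx]
    · have hn : 0 < ‖x‖ := norm_pos_iff.mpr hx
      have h1 : f (‖x‖⁻¹ • x) ≤ ‖f‖ - ε := hsub (by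
        rw [mem_closedBall_zero_iff, norm_smul, norm_inv, norm_norm, inv_mul_cancel₀ hn.ne'])
      rw [map_smul, smul_eq_mul, inv_mul_le_iff₀ hn] at h1
      linarith
  linarith

/-- If rotations of `u` almost in a common face with `u` are close to `u`, then the orbit of `u`
is dense in the unit sphere. -/
theorem IsBigPoint.exists_norm_sub_lt {u : X} (hu : IsBigPoint u)
    (h : ∀ ε > 0, ∃ δ > 0, ∀ S T : X ≃ₗᵢ[ℝ] X, 2 - δ < ‖S u + T u‖ → ‖S u - T u‖ < ε)
    {x : X} (hx : ‖x‖ = 1) {ε : ℝ} (hε : 0 < ε) : ∃ T : X ≃ₗᵢ[ℝ] X, ‖x - T u‖ < ε := by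
  obtain ⟨δ, hδ, hS⟩ := h (ε / 2) (by positivity)
  obtain ⟨f, hf, hfx⟩ := exists_dual_vector'' ℝ x
  rw [hx] at hfx
  simp only [RCLike.ofReal_real_eq_id, id] at hfx
  have hf1 : 1 ≤ ‖f‖ := by
    have := f.le_opNorm x
    rw [hfx, hx] at this
    simpa using this
  obtain ⟨T, hT⟩ := hu.exists_lt_apply f (half_pos hδ)
  refine ⟨T, ?_⟩
  have hsub := hu.closedBall_subset
    (C := {y | y ∈ Set.univ ∧ dist y (T u) + (4 / δ) • (f : X →ₗ[ℝ] ℝ) y ≤ ε / 2 + 4 / δ})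
    ?_ ?_ ?_
  · have hxC := (hsub (by rw [mem_closedBall_zero_iff, hx])).2
    simp [hfx, dist_eq_norm] at hxC
    linarith
  · simp only [Set.mem_univ, true_and]
    refine isClosed_le ?_ continuous_const
    simp only [ContinuousLinearMap.coe_coe]
    fun_prop
  · refine ConvexOn.convex_le ?_ _
    exact (convexOn_dist (T u) convex_univ).add
      (((f : X →ₗ[ℝ] ℝ).convexOn convex_univ).smul (by positivity))
  · intro S
    refine ⟨Set.mem_univ _, ?_⟩
    rw [dist_eq_norm]
    have hfS : f (S u) ≤ 1 := by
      have := StrongDual.apply_le_norm hf (S u)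
      rwa [S.norm_map, hu.1] at this
    simp only [ContinuousLinearMap.coe_coe, smul_eq_mul]
    by_cases hs : 1 - δ / 2 < f (S u)
    · have h1 : 2 - δ < ‖S u + T u‖ := by
        have := StrongDual.apply_le_norm hf (S u + T u)
        rw [map_add] at this
        linarith
      have h2 := hS S T h1
      have h3 : 0 ≤ 4 / δ * (1 - f (S u)) := mul_nonneg (by positivity) (by linarith)
      linarith
    · push Not at hs
      have h1 : ‖S u - T u‖ ≤ 2 := by
        refine (norm_sub_le _ _).trans ?_
        rw [S.norm_map, T.norm_map, hu.1]; norm_num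
      have h3 : 4 / δ * (δ / 2) ≤ 4 / δ * (1 - f (S u)) :=
        mul_le_mul_of_nonneg_left (by linarith) (by positivity)
      have h4 : 4 / δ * (δ / 2) = 2 := by field_simp; norm_num
      linarith

/-- If the functional of a bicontractive pair at `u` changes little under rotations of `u` almost
in a common face with `u`, then its orbit is dense in the dual unit sphere. -/
theorem IsBigPoint.exists_norm_sub_dualRotation_lt {u : X} (hu : IsBigPoint u)
    {p : StrongDual ℝ X} (hp : IsBicontractivePair u p)
    (hnorming : ∀ x : X, ∀ ε > 0, ∃ T : X ≃ₗᵢ[ℝ] X, ‖x‖ - ε < dualRotation T p x)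
    (h : ∀ ε > 0, ∃ δ > 0, ∀ S T : X ≃ₗᵢ[ℝ] X, 2 - δ < ‖S u + T u‖ →
      ‖dualRotation S p - dualRotation T p‖ < ε)
    {f : StrongDual ℝ X} (hf : ‖f‖ = 1) {ε : ℝ} (hε : 0 < ε) :
    ∃ T : X ≃ₗᵢ[ℝ] X, ‖f - dualRotation T p‖ < ε := by
  obtain ⟨δ, hδ, hS⟩ := h (ε / 4) (by positivity)
  obtain ⟨T, hT⟩ := hu.exists_lt_apply f (ε := ε / 4 * (δ / 2)) (by positivity)
  rw [hf] at hT
  refine ⟨T, ?_⟩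
  have hall : ∀ (S : X ≃ₗᵢ[ℝ] X) (z : X), dualRotation S p (z + (2 / δ * ‖z‖) • T u)
      ≤ dualRotation T p z + ε / 4 * ‖z‖ + 2 / δ * ‖z‖ := by
    intro S z
    have hpS := hp.rotate S
    have hpT := hp.rotate T
    rw [map_add, map_smul, smul_eq_mul]
    set φ := dualRotation S p
    set ψ := dualRotation T p
    have h1 : φ (T u) ≤ 1 := hpT.norm_vec ▸ StrongDual.apply_le_norm hpS.norm_le (T u)
    have hnz := norm_nonneg z
    have h5 : φ z - ψ z ≤ ‖φ - ψ‖ * ‖z‖ := (le_abs_self _).trans ((φ - ψ).le_opNorm z)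
    by_cases hs : 1 - δ < φ (T u)
    · have h2 : 2 - δ < ‖S u + T u‖ := by
        have := StrongDual.apply_le_norm hpS.norm_le (S u + T u)
        rw [map_add, hpS.apply_self] at this
        linarith
      have h3 := hS S T h2
      have h4 : 2 / δ * ‖z‖ * φ (T u) ≤ 2 / δ * ‖z‖ * 1 :=
        mul_le_mul_of_nonneg_left h1 (by positivity)
      have h6 := mul_le_mul_of_nonneg_right h3.le hnz
      linarith
    · push Not at hs
      have h2 : ‖φ - ψ‖ ≤ 2 := (norm_sub_le _ _).trans (by linarith [hpS.norm_le, hpT.norm_le])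
      have h3 : 2 / δ * ‖z‖ * φ (T u) ≤ 2 / δ * ‖z‖ * (1 - δ) :=
        mul_le_mul_of_nonneg_left hs (by positivity)
      have h4 : 2 / δ * ‖z‖ * (1 - δ) = 2 / δ * ‖z‖ - 2 * ‖z‖ := by field_simp
      have h6 := mul_le_mul_of_nonneg_right h2 hnz
      have h7 : 0 ≤ ε / 4 * ‖z‖ := by positivity
      linarith
  have hle : ‖f - dualRotation T p‖ ≤ ε / 2 := by
    refine StrongDual.norm_le_of_apply_le (by positivity) fun z => ?_
    have h1 : ‖z + (2 / δ * ‖z‖) • T u‖ ≤ dualRotation T p z + ε / 4 * ‖z‖ + 2 / δ * ‖z‖ := by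
      refine le_of_forall_pos_le_add fun η hη => ?_
      obtain ⟨S, hS'⟩ := hnorming (z + (2 / δ * ‖z‖) • T u) η hη
      linarith [hall S z]
    have h2 := StrongDual.apply_le_norm hf.le (z + (2 / δ * ‖z‖) • T u)
    rw [map_add, map_smul, smul_eq_mul] at h2
    have h3 : 2 / δ * ‖z‖ * (1 - ε / 4 * (δ / 2)) ≤ 2 / δ * ‖z‖ * f (T u) :=
      mul_le_mul_of_nonneg_left hT.le (by positivity)
    have h4 : 2 / δ * ‖z‖ * (1 - ε / 4 * (δ / 2)) = 2 / δ * ‖z‖ - ε / 4 * ‖z‖ := by field_simp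
    rw [sub_apply]
    linarith
  linarith

theorem strictConvexSpace_of_dense_orbit {u : X}
    (h : ∀ ε > 0, ∃ δ > 0, ∀ S T : X ≃ₗᵢ[ℝ] X, 2 - δ < ‖S u + T u‖ → ‖S u - T u‖ < ε)
    (hd : ∀ x : X, ‖x‖ = 1 → ∀ ε > 0, ∃ T : X ≃ₗᵢ[ℝ] X, ‖x - T u‖ < ε) :
    StrictConvexSpace ℝ X := by
  refine StrictConvexSpace.of_norm_add_ne_two fun x y hx hy hne h2 => hne ?_
  refine eq_of_forall_dist_le fun ε hε => ?_
  obtain ⟨δ, hδ, hST⟩ := h (ε / 3) (by positivity)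
  obtain ⟨S, hS⟩ := hd x hx (min (ε / 3) (δ / 2)) (by positivity)
  obtain ⟨T, hT⟩ := hd y hy (min (ε / 3) (δ / 2)) (by positivity)
  obtain ⟨hS1, hS2⟩ := lt_min_iff.mp hS
  obtain ⟨hT1, hT2⟩ := lt_min_iff.mp hT
  have h3 : ‖x + y‖ ≤ ‖S u + T u‖ + ‖x - S u‖ + ‖y - T u‖ := by
    have : x + y = (S u + T u) + (x - S u) + (y - T u) := by abel
    rw [this]
    exact norm_add₃_le
  have h4 := hST S T (by linarith)
  rw [dist_eq_norm]
  have h5 : ‖x - y‖ ≤ ‖x - S u‖ + ‖S u - T u‖ + ‖-(y - T u)‖ := by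
    have : x - y = (x - S u) + (S u - T u) + -(y - T u) := by abel
    rw [this]
    exact norm_add₃_le
  rw [norm_neg] at h5
  linarith

theorem IsBigPoint.strictConvexSpace_dual {u : X} (hu : IsBigPoint u) {p : StrongDual ℝ X}
    (hp : IsBicontractivePair u p)
    (h : ∀ ε > 0, ∃ δ > 0, ∀ S T : X ≃ₗᵢ[ℝ] X, 2 - δ < ‖S u + T u‖ →
      ‖dualRotation S p - dualRotation T p‖ < ε)
    (hd : ∀ f : StrongDual ℝ X, ‖f‖ = 1 → ∀ ε > 0, ∃ T : X ≃ₗᵢ[ℝ] X, ‖f - dualRotation T p‖ < ε) :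
    StrictConvexSpace ℝ (StrongDual ℝ X) := by
  refine StrictConvexSpace.of_norm_add_ne_two fun f g hf hg hne h2 => hne ?_
  refine eq_of_forall_dist_le fun ε hε => ?_
  obtain ⟨δ, hδ, hST⟩ := h (ε / 4) (by positivity)
  obtain ⟨R, hR⟩ := hu.exists_lt_apply (f + g) (half_pos hδ)
  rw [h2, add_apply] at hR
  have key : ∀ f : StrongDual ℝ X, ‖f‖ = 1 → 1 - δ / 2 < f (R u) →
      ‖f - dualRotation R p‖ < ε / 2 := by
    intro f hf hfR
    obtain ⟨S, hS⟩ := hd f hf (min (ε / 4) (δ / 2)) (by positivity)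
    obtain ⟨hS1, hS2⟩ := lt_min_iff.mp hS
    have hpS := hp.rotate S
    have h3 : f (R u) - dualRotation S p (R u) ≤ ‖f - dualRotation S p‖ := by
      have := (le_abs_self _).trans ((f - dualRotation S p).le_opNorm (R u))
      rwa [R.norm_map, hu.1, mul_one, sub_apply] at this
    have h4 := StrongDual.apply_le_norm hpS.norm_le (S u + R u)
    rw [map_add, hpS.apply_self] at h4
    have h5 := hST S R (by linarith)
    have h6 := norm_sub_le_norm_sub_add_norm_sub f (dualRotation S p) (dualRotation R p)
    linarith
  have hfR : f (R u) ≤ 1 := by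
    have := StrongDual.apply_le_norm hf.le (R u)
    rwa [R.norm_map, hu.1] at this
  have hgR : g (R u) ≤ 1 := by
    have := StrongDual.apply_le_norm hg.le (R u)
    rwa [R.norm_map, hu.1] at this
  have h3 := key f hf (by linarith)
  have h4 := key g hg (by linarith)
  have h5 := norm_sub_le_norm_sub_add_norm_sub f (dualRotation R p) g
  rw [norm_sub_rev (dualRotation R p) g] at h5
  rw [dist_eq_norm]
  linarith

theorem rotation_dichotomy {u : X} {p : StrongDual ℝ X} (hp : IsBicontractivePair u p)
    (h : ∀ ε > 0, ∃ δ > 0, ∀ x : X, ‖x‖ ≤ 1 → 2 - δ < ‖u + x‖ → 1 - ε < p x) :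
    (∀ ε > 0, ∃ δ > 0, ∀ S T : X ≃ₗᵢ[ℝ] X, 2 - δ < ‖S u + T u‖ → ‖S u - T u‖ < ε) ∨
    (∀ ε > 0, ∃ δ > 0, ∀ S T : X ≃ₗᵢ[ℝ] X, 2 - δ < ‖S u + T u‖ →
      ‖dualRotation S p - dualRotation T p‖ < ε) := by
  have hnear : ∀ ε > 0, ∃ δ > 0, ∀ S T : X ≃ₗᵢ[ℝ] X, 2 - δ < ‖S u + T u‖ →
      1 - ε < dualRotation S p (T u) := by
    intro ε hε
    obtain ⟨δ, hδ, hx⟩ := h ε hε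
    refine ⟨δ, hδ, fun S T hST => hx (S.symm (T u)) ?_ ?_⟩
    · rw [S.symm.norm_map, T.norm_map, hp.norm_vec]
    · rw [← norm_add_rotation] at hST
      exact hST
  have hD : ∀ ε > 0, ∃ δ > 0, ∀ S T : X ≃ₗᵢ[ℝ] X, 2 - δ < ‖S u + T u‖ →
      ‖S u - T u‖ < ε ∨ ‖dualRotation S p - dualRotation T p‖ < ε := by
    intro ε hε
    obtain ⟨η, hη, hpair⟩ := IsBicontractivePair.norm_sub_lt_or_norm_sub_lt (Y := X) hε
    obtain ⟨δ, hδ, hST⟩ := hnear η hη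
    exact ⟨δ, hδ, fun S T h2 => hpair _ _ _ _ (hp.rotate S) (hp.rotate T) (hST S T h2)
      (hST T S (by rwa [add_comm]))⟩
  by_contra! hcon
  obtain ⟨⟨ε₁, hε₁, h₁⟩, ε₂, hε₂, h₂⟩ := hcon
  obtain ⟨δ₀, hδ₀, hδD⟩ := hD (min ε₁ ε₂ / 2) (by positivity)
  obtain ⟨δ₁, hδ₁, hδp⟩ := h (δ₀ / 2) (by positivity)
  obtain ⟨S₁, T₁, hst₁, hfar₁⟩ := h₁ (min δ₀ δ₁) (by positivity)
  obtain ⟨S₂, T₂, hst₂, hfar₂⟩ := h₂ (min δ₀ δ₁) (by positivity)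
  rw [← norm_add_rotation] at hst₁ hst₂
  rw [← norm_sub_rotation] at hfar₁
  rw [← norm_sub_dualRotation] at hfar₂
  set R₁ := T₁.trans S₁.symm
  set R₂ := T₂.trans S₂.symm
  have hm₁ := min_le_left δ₀ δ₁
  have hm₂ := min_le_right δ₀ δ₁
  have hm₃ := min_le_left ε₁ ε₂
  have hm₄ := min_le_right ε₁ ε₂
  have hR : ∀ R : X ≃ₗᵢ[ℝ] X, 2 - min δ₀ δ₁ < ‖u + R u‖ →
      1 - δ₀ / 2 < p (R u) ∧ (‖u - R u‖ < min ε₁ ε₂ / 2 ∨ ‖p - dualRotation R p‖ < min ε₁ ε₂ / 2) := by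
    intro R h2
    refine ⟨hδp (R u) (by rw [R.norm_map, hp.norm_vec]) (by linarith), ?_⟩
    have h3 := hδD (LinearIsometryEquiv.refl ℝ X) R (by simpa using (by linarith))
    exact h3
  obtain ⟨hp₁, hc₁⟩ := hR R₁ hst₁
  obtain ⟨hp₂, hc₂⟩ := hR R₂ hst₂
  have hc₁' := hc₁.resolve_left (by linarith)
  have hc₂' := hc₂.resolve_right (by linarith)
  have h3 := StrongDual.apply_le_norm hp.norm_le (R₁ u + R₂ u)
  rw [map_add] at h3
  rcases hδD R₁ R₂ (by linarith) with h4 | h4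
  · have h5 := norm_sub_le_norm_sub_add_norm_sub u (R₂ u) (R₁ u)
    rw [norm_sub_rev (R₂ u)] at h5
    linarith
  · have h5 := norm_sub_le_norm_sub_add_norm_sub p (dualRotation R₁ p) (dualRotation R₂ p)
    linarith

end

section

variable {X : Type*} [NormedAddCommGroup X] [NormedSpace ℝ X]

theorem innerProductSpaceable_of_isBicontractivePair {Y : Type*} [NormedAddCommGroup Y]
    [NormedSpace ℝ Y] [StrictConvexSpace ℝ Y] (hfin : ¬ FiniteDimensional ℝ Y)
    (h : ∀ y : Y, ‖y‖ = 1 → ∃ ψ : StrongDual ℝ Y, IsBicontractivePair y ψ) :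
    InnerProductSpaceable Y := by
  obtain ⟨J, hJ⟩ := exists_isSymmetricSupport h
  exact ⟨hJ.parallelogram hfin⟩

/-- The isometry of the dual induced by a surjective linear isometry. -/
noncomputable def dualRotationEquiv (T : X ≃ₗᵢ[ℝ] X) : StrongDual ℝ X ≃ₗᵢ[ℝ] StrongDual ℝ X where
  toFun := dualRotation T
  map_add' _ _ := rfl
  map_smul' _ _ := rfl
  invFun := dualRotation T.symm
  left_inv f := by ext x; simp
  right_inv f := by ext x; simp
  norm_map' := norm_dualRotation T

theorem innerProductSpaceable_of_dense_orbit [FiniteDimensional ℝ X] {u : X}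
    (hd : ∀ x : X, ‖x‖ = 1 → ∀ ε > 0, ∃ T : X ≃ₗᵢ[ℝ] X, ‖x - T u‖ < ε) :
    InnerProductSpaceable X := by
  refine innerProductSpaceable_of_dense_conjugates (NormedSpace.inclusionInDoubleDual ℝ X)
    (NormedSpace.inclusionInDoubleDualLi ℝ (E := X)).injective u fun x hx ε hε => ?_
  obtain ⟨T, hT⟩ := hd x hx ε hε
  exact ⟨T u, hT, dualRotationEquiv T.symm, fun _ => rfl⟩

theorem innerProductSpaceable_dual_of_dense_orbit [FiniteDimensional ℝ X] {p : StrongDual ℝ X}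
    (hd : ∀ f : StrongDual ℝ X, ‖f‖ = 1 → ∀ ε > 0, ∃ T : X ≃ₗᵢ[ℝ] X, ‖f - dualRotation T p‖ < ε) :
    InnerProductSpaceable (StrongDual ℝ X) := by
  refine innerProductSpaceable_of_dense_conjugates (ContinuousLinearMap.id ℝ (StrongDual ℝ X))
    Function.injective_id p fun f hf ε hε => ?_
  obtain ⟨T, hT⟩ := hd f hf ε hε
  exact ⟨dualRotation T p, hT, T.symm, fun _ => rfl⟩

theorem not_finiteDimensional_dual (h : ¬ FiniteDimensional ℝ X) :
    ¬ FiniteDimensional ℝ (StrongDual ℝ X) := fun _ =>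
  h (FiniteDimensional.of_injective (NormedSpace.inclusionInDoubleDualLi ℝ (E := X)).toLinearMap
    (NormedSpace.inclusionInDoubleDualLi ℝ (E := X)).injective)

theorem IsBicontractivePair.exists_lt_apply_of_tendsto {u : X} {p : StrongDual ℝ X}
    (hp : IsBicontractivePair u p)
    (h : ∀ x : ℕ → X, (∀ n, ‖x n‖ ≤ 1) → Tendsto (fun n => ‖u + x n‖) atTop (𝓝 2) →
      Tendsto (fun n => p (x n) • u) atTop (𝓝 u)) :
    ∀ ε > 0, ∃ δ > 0, ∀ x : X, ‖x‖ ≤ 1 → 2 - δ < ‖u + x‖ → 1 - ε < p x := by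
  intro ε hε
  by_contra! hcon
  choose x hx1 hx2 hx3 using fun n : ℕ => hcon (1 / ((n : ℝ) + 1)) (by positivity)
  have hup : ∀ n, ‖u + x n‖ ≤ 2 := fun n =>
    (norm_add_le _ _).trans (by rw [hp.norm_vec]; linarith [hx1 n])
  have hlow : Tendsto (fun n : ℕ => 2 - 1 / ((n : ℝ) + 1)) atTop (𝓝 2) := by
    simpa using tendsto_one_div_add_atTop_nhds_zero_nat.const_sub (2 : ℝ)
  have hlim := h x hx1 (tendsto_of_tendsto_of_tendsto_of_le_of_le hlow tendsto_const_nhds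
    (fun n => (hx2 n).le) hup)
  have h1 := (p.continuous.tendsto u).comp hlim
  simp only [Function.comp_def, map_smul, hp.apply_self, smul_eq_mul, mul_one] at h1
  have := le_of_tendsto' h1 hx3
  linarith

theorem IsBigPoint.exists_lt_dualRotation_apply {u : X} (hu : IsBigPoint u) {p : StrongDual ℝ X}
    (h : ∀ ε > 0, ∃ δ > 0, ∀ x : X, ‖x‖ ≤ 1 → 2 - δ < ‖u + x‖ → 1 - ε < p x)
    (x : X) {ε : ℝ} (hε : 0 < ε) : ∃ T : X ≃ₗᵢ[ℝ] X, ‖x‖ - ε < dualRotation T p x := by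
  by_cases hx : x = 0
  · exact ⟨LinearIsometryEquiv.refl ℝ X, by simp [hx, hε]⟩
  have hn : 0 < ‖x‖ := norm_pos_iff.mpr hx
  obtain ⟨δ, hδ, hp⟩ := h (ε / ‖x‖) (by positivity)
  set y := ‖x‖⁻¹ • x with hy
  have hy1 : ‖y‖ = 1 := by rw [hy, norm_smul, norm_inv, norm_norm, inv_mul_cancel₀ hn.ne']
  obtain ⟨g, hg, hgy⟩ := exists_dual_vector'' ℝ y
  rw [hy1] at hgy
  simp only [RCLike.ofReal_real_eq_id, id] at hgy
  have hg1 : 1 ≤ ‖g‖ := by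
    have := g.le_opNorm y
    rw [hgy, hy1] at this
    simpa using this
  obtain ⟨T, hT⟩ := hu.exists_lt_apply g hδ
  have h1 := StrongDual.apply_le_norm hg (T u + y)
  rw [map_add, hgy] at h1
  have h2 : ‖u + T.symm y‖ = ‖T u + y‖ := by
    rw [← T.norm_map]; simp
  have h3 := hp (T.symm y) (by rw [T.symm.norm_map, hy1]) (by linarith)
  refine ⟨T, ?_⟩
  rw [hy, map_smul, map_smul, smul_eq_mul, lt_inv_mul_iff₀ hn, mul_sub, mul_one,
    mul_div_cancel₀ _ hn.ne'] at h3
  exact h3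

theorem IsBigPoint.innerProductSpaceable {u : X} (hu : IsBigPoint u)
    {p : StrongDual ℝ X} (hp : IsBicontractivePair u p)
    (h : ∀ ε > 0, ∃ δ > 0, ∀ x : X, ‖x‖ ≤ 1 → 2 - δ < ‖u + x‖ → 1 - ε < p x) :
    InnerProductSpaceable X := by
  rcases rotation_dichotomy hp h with hI | hII
  · have hd : ∀ x : X, ‖x‖ = 1 → ∀ ε > 0, ∃ T : X ≃ₗᵢ[ℝ] X, ‖x - T u‖ < ε :=
      fun x hx ε hε => hu.exists_norm_sub_lt hI hx hε
    by_cases hfin : FiniteDimensional ℝ X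
    · exact innerProductSpaceable_of_dense_orbit hd
    · have := strictConvexSpace_of_dense_orbit hI hd
      refine innerProductSpaceable_of_isBicontractivePair hfin fun x hx =>
        exists_isBicontractivePair_of_dense hx fun ε hε => ?_
      obtain ⟨T, hT⟩ := hd x hx ε hε
      exact ⟨T u, dualRotation T p, hp.rotate T, hT⟩
  · have hd : ∀ f : StrongDual ℝ X, ‖f‖ = 1 → ∀ ε > 0,
        ∃ T : X ≃ₗᵢ[ℝ] X, ‖f - dualRotation T p‖ < ε := fun f hf ε hε =>
      hu.exists_norm_sub_dualRotation_lt hp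
        (fun x ε hε => hu.exists_lt_dualRotation_apply h x hε) hII hf hε
    apply InnerProductSpaceable.of_strongDual
    by_cases hfin : FiniteDimensional ℝ X
    · exact innerProductSpaceable_dual_of_dense_orbit hd
    · have := hu.strictConvexSpace_dual hp hII hd
      refine innerProductSpaceable_of_isBicontractivePair (not_finiteDimensional_dual hfin)
        fun f hf => ?_
      choose T hT using fun n : ℕ => hd f hf (1 / ((n : ℝ) + 1)) (by positivity)
      have hlim : Tendsto (fun n => dualRotation (T n) p) atTop (𝓝 f) := by
        rw [tendsto_iff_norm_sub_tendsto_zero]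
        refine squeeze_zero (fun _ => norm_nonneg _) (fun n => ?_)
          tendsto_one_div_add_atTop_nhds_zero_nat
        rw [norm_sub_rev]
        exact (hT n).le
      refine exists_isBicontractivePair_dual_of_tendsto hf (fun n => T n u)
        (fun n => dualRotation (T n) p) (fun n => hp.rotate (T n))
        (fun x => (ContinuousLinearMap.apply ℝ ℝ x).continuous.tendsto f |>.comp hlim) ?_
      rw [← tendsto_sub_nhds_zero_iff]
      refine squeeze_zero_norm (fun n => ?_) (tendsto_iff_norm_sub_tendsto_zero.mp hlim)
      have h1 : f (T n u) - 1 = (f - dualRotation (T n) p) (T n u) := by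
        rw [sub_apply, (hp.rotate (T n)).apply_self]
      have h2 := (f - dualRotation (T n) p).le_opNorm (T n u)
      rwa [(hp.rotate (T n)).norm_vec, mul_one, norm_sub_rev f, ← h1] at h2

theorem DualIsWeakStarLUR.strictConvexSpace (h : DualIsWeakStarLUR X) :
    StrictConvexSpace ℝ (StrongDual ℝ X) := by
  refine StrictConvexSpace.of_norm_add_ne_two fun f g hf hg hne h2 => hne ?_
  have h1 := h f hf (fun _ => g) (fun _ => hg.le) (by rw [h2]; exact tendsto_const_nhds)
  exact StrongDual.toWeakDual.injective (tendsto_nhds_unique h1 tendsto_const_nhds)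

theorem DualIsWeakStarLUR.exists_tendsto_dualRotation (h : DualIsWeakStarLUR X) {u : X}
    (hu : IsBigPoint u) {p : StrongDual ℝ X} (hp : IsBicontractivePair u p)
    {f : StrongDual ℝ X} (hf : ‖f‖ = 1) :
    ∃ T : ℕ → X ≃ₗᵢ[ℝ] X, Tendsto (fun n => f (T n u)) atTop (𝓝 1) ∧
      Tendsto (fun n => StrongDual.toWeakDual (dualRotation (T n) p)) atTop
        (𝓝 (StrongDual.toWeakDual f)) := by
  choose T hT using fun n : ℕ =>
    hu.exists_lt_apply f (ε := 1 / ((n : ℝ) + 1)) (by positivity)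
  rw [hf] at hT
  have hlow : Tendsto (fun n : ℕ => 1 - 1 / ((n : ℝ) + 1)) atTop (𝓝 1) := by
    simpa using tendsto_one_div_add_atTop_nhds_zero_nat.const_sub (1 : ℝ)
  have hfT : Tendsto (fun n => f (T n u)) atTop (𝓝 1) :=
    tendsto_of_tendsto_of_tendsto_of_le_of_le hlow tendsto_const_nhds (fun n => (hT n).le)
      fun n => (hp.rotate (T n)).norm_vec ▸ StrongDual.apply_le_norm hf.le (T n u)
  refine ⟨T, hfT, h f hf _ (fun n => (hp.rotate (T n)).norm_le) ?_⟩
  have h2 : Tendsto (fun n => f (T n u) + 1) atTop (𝓝 2) := by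
    simpa [one_add_one_eq_two] using hfT.add_const 1
  refine tendsto_of_tendsto_of_tendsto_of_le_of_le h2 tendsto_const_nhds (fun n => ?_) fun n => ?_
  · have h1 := (le_abs_self _).trans ((f + dualRotation (T n) p).le_opNorm (T n u))
    rwa [(hp.rotate (T n)).norm_vec, mul_one, add_apply, (hp.rotate (T n)).apply_self] at h1
  · refine (norm_add_le _ _).trans ?_
    linarith [(hp.rotate (T n)).norm_le]

theorem DualIsWeakStarLUR.innerProductSpaceable (h : DualIsWeakStarLUR X) {u : X}
    (hu : IsBigPoint u) {p : StrongDual ℝ X} (hp : IsBicontractivePair u p) :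
    InnerProductSpaceable X := by
  apply InnerProductSpaceable.of_strongDual
  by_cases hfin : FiniteDimensional ℝ X
  · refine innerProductSpaceable_dual_of_dense_orbit (p := p) fun f hf ε hε => ?_
    obtain ⟨T, -, hT⟩ := h.exists_tendsto_dualRotation hu hp hf
    have hfinW : FiniteDimensional ℝ (WeakDual ℝ X) :=
      Module.Finite.equiv (StrongDual.toWeakDual (𝕜 := ℝ) (E := X))
    have hcont : Continuous (StrongDual.toWeakDual (𝕜 := ℝ) (E := X)).symm :=
      (StrongDual.toWeakDual (𝕜 := ℝ) (E := X)).symm.toLinearMap.continuous_of_finiteDimensional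
    have hlim := (hcont.tendsto _).comp hT
    obtain ⟨n, hn⟩ := ((Metric.tendsto_nhds.mp hlim) ε hε).exists
    refine ⟨T n, ?_⟩
    rw [dist_comm, dist_eq_norm] at hn
    simpa using hn
  · have := h.strictConvexSpace
    refine innerProductSpaceable_of_isBicontractivePair (not_finiteDimensional_dual hfin)
      fun f hf => ?_
    obtain ⟨T, hfT, hT⟩ := h.exists_tendsto_dualRotation hu hp hf
    exact exists_isBicontractivePair_dual_of_tendsto hf (fun n => T n u)
      (fun n => dualRotation (T n) p) (fun n => hp.rotate (T n))
      (tendsto_iff_forall_eval_tendsto_topDualPairing.mp hT) hfT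

end

theorem theorem3p2 {X : Type*} [NormedAddCommGroup X] [NormedSpace ℝ X] [CompleteSpace X]
    (u : X) (hu : IsBigPoint u)
    (P : X →L[ℝ] X) (hP : IsBicontractiveProjectionOnto P u)
    (h : (∀ x : ℕ → X, (∀ n, ‖x n‖ ≤ 1) → Tendsto (fun n => ‖u + x n‖) atTop (𝓝 2) →
            Tendsto (fun n => P (x n)) atTop (𝓝 u)) ∨
          DualIsWeakStarLUR X) :
    IsIsometricallyHilbert X := by
  obtain ⟨p, hp, hPp⟩ := hP.exists_isBicontractivePair hu.1
  apply InnerProductSpaceable.isIsometricallyHilbert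
  rcases h with ha | hb
  · simp only [hPp] at ha
    exact IsBigPoint.innerProductSpaceable hu hp (hp.exists_lt_apply_of_tendsto ha)
  · exact hb.innerProductSpaceable hu hp
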